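/- Consider online multi-label logistic regression. At each round $t=1,\dots,T$ a feature vector $x_t\in\mathbb R^d$ with $\|x_t\|_\infty\le 1$ is revealed, an algorithm $\mathcal A$ outputs a probability distribution $\mathcal A(S_{t-1},x_t,\cdot)$ on the label set $\{1,\dots,m\}$ that depends on the past examples $S_{t-1}=((x_s,y_s))_{s<t}$ and on $x_t$, and a label $y_t$ is observed. A model is $\theta=(\theta^{(1)},\dots,\theta^{(m)})$ with $\theta^{(k)}\in\mathbb R^d$ and assigns the probability $p(y\mid x,\theta)=\exp(x^{\mathsf T}\theta^{(y)})/\sum_{k=1}^m\exp(x^{\mathsf T}\theta^{(k)})$ to label $y$. With $\Theta_B=\{\theta:\|\theta^{(k)}\|_\infty\le B\ \text{for } k=1,\dots,m\}$, the regret of $\mathcal A$ on $S_T=((x_t,y_t))_{t\le T}$ is $$\mathrm{Regret}_B(\mathcal A,S_T)=\sup_{\theta\in\Theta_B}\Big[\sum_{t=1}^T-\log\mathcal A(S_{t-1},x_t,y_t)+\sum_{t=1}^T\log p(y_t\mid x_t,\theta)\Big]\in(-\infty,+\infty].$$ **Theorem.** Fix $\varepsilon>0$ and $B_0>0$. Let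 $d=d(T)\ge 1$ and $m=m(T)\ge 1$ be integers and $B=B(T)$ reals with $B(T)\ge B_0$ for all large $T$ (for example $B$ constant and positive, or $B=\gamma\log T$ with a constant $\gamma>0$), and suppose that $m=o\big((T/d)^{1-\varepsilon}\big)$ as $T\to\infty$. Then there is a sequence $r_T\to 0$, which does not depend on the algorithm, such that for all sufficiently large $T$ and every algorithm $\mathcal A$ (which may depend on $T,d,m,B$) there exists a sequence $S_T$ with $\|x_t\|_\infty\le 1$ for all $t$ and $$\mathrm{Regret}_B(\mathcal A,S_T)\ \ge\ (1-r_T)\,\frac{d(m-1)}{2}\,\log\frac{T}{md}.$$ -/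

import Mathlib

open Filter Topology Asymptotics

noncomputable section

namespace OnlineLogistic

/-- A `d`-dimensional feature vector; its Mathlib norm is the sup norm. -/
abbrev Feature (d : ℕ) : Type := Fin d → ℝ

/-- A feature vector together with one of `m` labels. -/
abbrev Example (d m : ℕ) : Type := Feature d × Fin m

/-- A parameter: one `d`-dimensional weight vector for each of the `m` labels. -/
abbrev Param (d m : ℕ) : Type := Fin m → Feature d

/-- The comparator class: each label's weight vector has sup norm at most `B`. -/
def comparators (d m : ℕ) (B : ℝ) : Set (Param d m) :=
  {θ | ∀ k, ‖θ k‖ ≤ B}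

/-- The multi-label logistic (softmax) probability of label `y` for features `x`. -/
def modelProb {d m : ℕ} (θ : Param d m) (x : Feature d) (y : Fin m) : ℝ :=
  Real.exp (x ⬝ᵥ θ y) / ∑ k, Real.exp (x ⬝ᵥ θ k)

/-- Logarithmic loss of the model `θ` on one example. -/
def modelLoss {d m : ℕ} (θ : Param d m) (z : Example d m) : ℝ :=
  -Real.log (modelProb θ z.1 z.2)

/-- Total loss of the model `θ` on a sequence of `T` examples. -/
def modelTotalLoss {d m T : ℕ} (θ : Param d m) (S : Fin T → Example d m) : ℝ :=
  ∑ t, modelLoss θ (S t)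

/-- An online algorithm: from the `n` examples seen so far and the current features it
returns a probability distribution on the `m` labels. -/
abbrev Algorithm (d m : ℕ) : Type :=
  (n : ℕ) → (Fin n → Example d m) → Feature d → PMF (Fin m)

/-- The examples that precede round `t`. -/
def history {d m T : ℕ} (S : Fin T → Example d m) (t : Fin T) : Fin t → Example d m :=
  fun s => S (Fin.castLE t.isLt.le s)

/-- Logarithmic loss of the algorithm in round `t`. It is `⊤` if the algorithm gives the
observed label probability zero. -/
def algLoss {d m T : ℕ} (A : Algorithm d m) (S : Fin T → Example d m) (t : Fin T) : EReal :=
  -ENNReal.log (A t (history S t) (S t).1 (S t).2)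

/-- Total loss of the algorithm on a sequence of `T` examples. -/
def algTotalLoss {d m T : ℕ} (A : Algorithm d m) (S : Fin T → Example d m) : EReal :=
  ∑ t, algLoss A S t

/-- Regret relative to a fixed comparator. -/
def regretAgainst {d m T : ℕ} (A : Algorithm d m) (S : Fin T → Example d m)
    (θ : Param d m) : EReal :=
  algTotalLoss A S - (modelTotalLoss θ S : EReal)

/-- Regret relative to the best comparator in the class with norm bound `B`. -/
def regret {d m T : ℕ} (B : ℝ) (A : Algorithm d m) (S : Fin T → Example d m) : EReal :=
  ⨆ θ ∈ comparators d m B, regretAgainst A S θ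

end OnlineLogistic

end

/-!
The lower bound is Shtarkov's argument for log loss. Fix the feature vectors in advance. The
probabilities that the algorithm assigns to the label sequences `y` then sum to one
(`sum_prod_pmf_eq_one`). So if `P y` is at most the probability that the best comparator assigns
to `y`, some `y` receives probability at most `P y / ∑ P` from the algorithm, and the regret on it
is at least `log (∑ P)` (`exists_log_sum_le_regret`).

The features are the standard basis vectors `e_j`, each in `s` rounds, and the zero vector in the
remaining rounds. On `e_j` the model is the softmax of the `j`-th coordinates of its weight
vectors, and on the zero vector it is uniform whatever the parameter is. Hence `∑ P` is the `d`-th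
power of the same sum for a single memoryless source with `s` draws from `m` letters
(`exists_mul_log_sum_le_regret`).

For a single source, only sequences whose letter counts `k` lie in a window `a ≤ k j < a + w` are
used. If `w ≤ B * a`, the empirical distribution `k / s` is the softmax of a vector of sup norm at
most `B` (`exists_softmax_eq_div`), because its entries are within a factor `1 + B ≤ exp B` of
`1 / m`. By Stirling's formula each vector of counts contributes at least `√s / ∏ j, (e * √(k j))`
(`le_card_mul_prod_pow`). The counts must add up to `s`; instead of fixing `s` beforehand, a
pigeonhole over the possible sums finds an `s` that is attained by at least `w ^ (m - 1) / m`
vectors (`exists_many_with_equal_sum`), and rounds left over have zero features, so they cost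
nothing.

With `ρ = T / (m d)`, `a = ⌊ρ / 2⌋` and `w = ⌊min B₀ 1 * a⌋`, this gives a regret of at least
`d (m - 1) / 2 * (log ρ - C)`, where `C` depends on `B₀` only
(`exists_le_regret_of_ratio_large`). For `ε < 1` the growth condition on `m` forces `ρ → ∞`, so
that `C` is negligible against `log ρ`. For `ε ≥ 1` it forces `ρ ≤ 1` eventually, so that the
claimed bound is at most zero; a nonnegative regret can always be enforced
(`exists_zero_le_regret`).
-/

namespace OnlineLogistic

/-! ### Shtarkov's bound for online algorithms -/

/-- Chaining conditional distributions, each of which may depend on the symbols drawn so far,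
gives a probability distribution on sequences. -/
theorem sum_prod_pmf_eq_one {α : Type*} [Fintype α]
    (q : (n : ℕ) → (Fin n → α) → PMF α) (T : ℕ) :
    ∑ y : Fin T → α, ∏ t : Fin T, q t (fun s => y (Fin.castLE t.isLt.le s)) (y t) = 1 := by
  induction T with
  | zero => simp
  | succ T ih =>
    rw [← (Fin.snocEquiv (fun _ => α)).sum_comp, Fintype.sum_prod_type_right, ← ih]
    refine Finset.sum_congr rfl fun y _ => ?_
    have key : ∀ a : α, (∏ t : Fin (T + 1), q t (fun s =>
        (Fin.snocEquiv (fun _ => α)) (a, y) (Fin.castLE t.isLt.le s))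
          ((Fin.snocEquiv (fun _ => α)) (a, y) t))
        = (∏ t : Fin T, q t (fun s => y (Fin.castLE t.isLt.le s)) (y t)) * q T y a := by
      intro a
      rw [Fin.prod_univ_castSucc]
      have h1 : ∀ t : Fin T, (fun s : Fin t =>
          (Fin.snocEquiv (fun _ => α)) (a, y) (Fin.castLE t.castSucc.isLt.le s))
          = fun s => y (Fin.castLE t.isLt.le s) := by
        intro t; funext s
        exact Fin.snoc_castSucc (α := fun _ => α) a y (Fin.castLE t.isLt.le s)
      have h2 : (fun s : Fin T =>
          (Fin.snocEquiv (fun _ => α)) (a, y) (Fin.castLE (Fin.last T).isLt.le s)) = y := by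
        funext s
        exact Fin.snoc_castSucc (α := fun _ => α) a y s
      congr 1
      · refine Finset.prod_congr rfl fun t _ => ?_
        have h3 : (Fin.snocEquiv (fun _ => α)) (a, y) t.castSucc = y t :=
          Fin.snoc_castSucc (α := fun _ => α) a y t
        rw [h3]
        exact congrArg (fun h => q t h (y t)) (h1 t)
      · have h4 : (Fin.snocEquiv (fun _ => α)) (a, y) (Fin.last T) = a :=
          Fin.snoc_last (α := fun _ => α) a y
        rw [h4]
        exact congrArg (fun h => q T h a) h2
    simp_rw [key]
    rw [← Finset.mul_sum, ← tsum_fintype (L := .unconditional _), PMF.tsum_coe, mul_one]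

/-- The bound `q i ≤ 1` keeps every term of the sum different from `⊥`, so that no undefined sum of
`⊤` and `⊥` occurs. -/
theorem sum_neg_log_eq_neg_log_prod {ι : Type*} (s : Finset ι) (q : ι → ENNReal)
    (hq : ∀ i ∈ s, q i ≤ 1) :
    ∑ i ∈ s, -ENNReal.log (q i) = -ENNReal.log (∏ i ∈ s, q i) := by
  classical
  induction s using Finset.induction_on with
  | empty => simp
  | insert a s ha ih =>
    rw [Finset.sum_insert ha, Finset.prod_insert ha, ENNReal.log_mul_add,
      ih fun i hi => hq i (Finset.mem_insert_of_mem hi), EReal.neg_add, sub_eq_add_neg]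
    · right
      exact (ENNReal.log_lt_top_iff.2 (lt_of_le_of_lt
        (Finset.prod_le_one' fun i hi => hq i (Finset.mem_insert_of_mem hi)) ENNReal.one_lt_top)).ne
    · left
      exact (ENNReal.log_lt_top_iff.2 (lt_of_le_of_lt
        (hq a (Finset.mem_insert_self a s)) ENNReal.one_lt_top)).ne

theorem modelProb_pos {d m : ℕ} (θ : Param d m) (x : Feature d) (y : Fin m) :
    0 < modelProb θ x y :=
  div_pos (Real.exp_pos _) (Finset.sum_pos (fun _ _ => Real.exp_pos _) ⟨y, Finset.mem_univ y⟩)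

theorem modelTotalLoss_eq_neg_log_prod {d m T : ℕ} (θ : Param d m) (S : Fin T → Example d m) :
    modelTotalLoss θ S = -Real.log (∏ t, modelProb θ (S t).1 (S t).2) := by
  rw [Real.log_prod fun t _ => (modelProb_pos θ (S t).1 (S t).2).ne']
  simp [modelTotalLoss, modelLoss]

/-- Shtarkov's lower bound for fixed features `x`: if some comparator in the class assigns to `y` at
least the weight `P y`, whenever this is positive, then the regret can be forced up to
`log (∑ y, P y)`. -/
theorem exists_log_sum_le_regret {d m T : ℕ} {B : ℝ} (A : Algorithm d m) (x : Fin T → Feature d)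
    (P : (Fin T → Fin m) → ℝ) (hP0 : ∀ y, 0 ≤ P y) (hsum : 0 < ∑ y, P y)
    (hP : ∀ y, 0 < P y → ∃ θ ∈ comparators d m B, P y ≤ ∏ t, modelProb θ (x t) (y t)) :
    ∃ y : Fin T → Fin m,
      ((Real.log (∑ y, P y) : ℝ) : EReal) ≤ regret B A fun t => (x t, y t) := by
  classical
  set W := ∑ y, P y with hW
  -- The features are extended by zero, so that the label distributions of `A` are defined
  -- for histories of every length.
  let x' : ℕ → Feature d := fun n => if h : n < T then x ⟨n, h⟩ else 0
  have hx' : ∀ t : Fin T, x' t = x t := fun t => by simp [x']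
  let q : (n : ℕ) → (Fin n → Fin m) → PMF (Fin m) :=
    fun n h => A n (fun s => (x' s, h s)) (x' n)
  let Q : (Fin T → Fin m) → ENNReal :=
    fun y => ∏ t : Fin T, q t (fun s => y (Fin.castLE t.isLt.le s)) (y t)
  have hQ1 : ∑ y, Q y = 1 := sum_prod_pmf_eq_one q T
  have hQle : ∀ y, Q y ≤ 1 := fun y => by
    rw [← hQ1]; exact Finset.single_le_sum (fun _ _ => zero_le) (Finset.mem_univ y)
  have hQtop : ∀ y, Q y ≠ ⊤ := fun y => ((hQle y).trans_lt ENNReal.one_lt_top).ne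
  have hQr : ∑ y, (Q y).toReal = 1 := by
    rw [← ENNReal.toReal_sum fun y _ => hQtop y, hQ1, ENNReal.toReal_one]
  -- Otherwise `W * Q` would exceed `P` on the support of `P`, although both have total mass `W`.
  obtain ⟨y, hyP, hy⟩ : ∃ y, 0 < P y ∧ W * (Q y).toReal ≤ P y := by
    by_contra! hcon
    have h0 : ∃ y, 0 < P y := by
      by_contra! h
      exact absurd (Finset.sum_nonpos fun y _ => h y) (not_le.2 hsum)
    obtain ⟨y₀, hy₀⟩ := h0
    have : W < ∑ y, W * (Q y).toReal := by
      rw [hW]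
      refine Finset.sum_lt_sum (fun y _ => ?_) ⟨y₀, Finset.mem_univ _, hcon y₀ hy₀⟩
      rcases (hP0 y).eq_or_lt with h | h
      · rw [← h]; positivity
      · exact (hcon y h).le
    rw [← Finset.mul_sum, hQr, mul_one] at this
    exact lt_irrefl _ this
  obtain ⟨θ, hθ, hPθ⟩ := hP y hyP
  refine ⟨y, le_trans ?_ (le_iSup₂ θ hθ)⟩
  have hhist : ∀ t : Fin T,
      algLoss A (fun t => (x t, y t)) t
        = -ENNReal.log (q t (fun s => y (Fin.castLE t.isLt.le s)) (y t)) := by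
    intro t
    have h1 : history (fun t => (x t, y t)) t
        = fun s : Fin t => (x' s, y (Fin.castLE t.isLt.le s)) := by
      funext s
      have := hx' (Fin.castLE t.isLt.le s)
      simp only [Fin.val_castLE] at this
      simp [history, this]
    simp only [algLoss, h1, q, hx']
  have halg : algTotalLoss A (fun t => (x t, y t)) = -ENNReal.log (Q y) := by
    unfold algTotalLoss
    rw [Finset.sum_congr rfl fun t _ => hhist t]
    exact sum_neg_log_eq_neg_log_prod _ _ fun t _ => PMF.coe_le_one _ _
  have hlogQ : ENNReal.log (Q y) ≤ ((Real.log (P y / W) : ℝ) : EReal) := by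
    rw [← ENNReal.log_ofReal_of_pos (div_pos hyP hsum)]
    refine ENNReal.log_le_log ?_
    rw [← ENNReal.ofReal_toReal (hQtop y)]
    refine ENNReal.ofReal_le_ofReal ?_
    rw [le_div_iff₀ hsum, mul_comm]
    exact hy
  have hloss : -modelTotalLoss θ (fun t => (x t, y t)) ≥ Real.log (P y) := by
    rw [modelTotalLoss_eq_neg_log_prod, neg_neg]
    exact Real.log_le_log hyP hPθ
  rw [regretAgainst, halg, sub_eq_add_neg]
  calc ((Real.log W : ℝ) : EReal)
      = ((-Real.log (P y / W) : ℝ) : EReal) + ((Real.log (P y) : ℝ) : EReal) := by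
        rw [← EReal.coe_add, Real.log_div hyP.ne' hsum.ne']; congr 1; ring
    _ ≤ -ENNReal.log (Q y) + ((-modelTotalLoss θ (fun t => (x t, y t)) : ℝ) : EReal) := by
        refine add_le_add ?_ (EReal.coe_le_coe_iff.2 hloss)
        rw [EReal.coe_neg]
        exact EReal.neg_le_neg_iff.2 hlogQ
    _ = _ := by rw [EReal.coe_neg]

/-! ### Reduction to independent memoryless sources -/

/-- The probability of the letter `k` in the exponential parametrization `v` of the distributions on
`m` letters: the model for the features `Pi.single j 1`, as a function of the `j`-th coordinates of
the weight vectors. -/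
noncomputable def softmax {m : ℕ} (v : Fin m → ℝ) (k : Fin m) : ℝ :=
  Real.exp (v k) / ∑ i, Real.exp (v i)

theorem modelProb_single {d m : ℕ} (θ : Param d m) (j : Fin d) (k : Fin m) :
    modelProb θ (Pi.single j 1) k = softmax (fun i => θ i j) k := by
  simp [modelProb, softmax]

theorem modelProb_zero {d m : ℕ} (θ : Param d m) (k : Fin m) :
    modelProb θ 0 k = 1 / (m : ℝ) := by
  simp [modelProb]

/-- If `w z` is at most the probability of `z` under some memoryless source with parameters bounded
by `B`, then `d` independent copies of the source, one for each coordinate, force a regret of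
`d * log (∑ z, w z)`. The `r` rounds outside the `d` blocks of length `s` have zero features. -/
theorem exists_mul_log_sum_le_regret {d m s r T : ℕ} (hm : 1 ≤ m) {B : ℝ} (hB : 0 ≤ B)
    (hT : d * s + r = T) (w : (Fin s → Fin m) → ℝ) (hw0 : ∀ z, 0 ≤ w z) (hsum : 0 < ∑ z, w z)
    (hw : ∀ z, 0 < w z → ∃ v : Fin m → ℝ, (∀ k, |v k| ≤ B) ∧ w z ≤ ∏ i, softmax v (z i))
    (A : Algorithm d m) :
    ∃ S : Fin T → Example d m, (∀ t, ‖(S t).1‖ ≤ 1) ∧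
      (((d : ℝ) * Real.log (∑ z, w z) : ℝ) : EReal) ≤ regret B A S := by
  classical
  let e : Fin T ≃ (Fin d × Fin s) ⊕ Fin r :=
    ((finProdFinEquiv.sumCongr (Equiv.refl _)).trans
      (finSumFinEquiv.trans (finCongr hT))).symm
  let x₀ : (Fin d × Fin s) ⊕ Fin r → Feature d :=
    Sum.elim (fun p => Pi.single p.1 1) (fun _ => 0)
  -- A label sequence is one word of length `s` for each coordinate, and a word of length `r` for
  -- the rounds with zero features.
  let E : (Fin T → Fin m) ≃ (Fin d → Fin s → Fin m) × (Fin r → Fin m) :=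
    (e.arrowCongr (Equiv.refl _)).trans ((Equiv.sumArrowEquivProdArrow _ _ _).trans
      ((Equiv.curry _ _ _).prodCongr (Equiv.refl _)))
  have hE1 : ∀ y j i, (E y).1 j i = y (e.symm (Sum.inl (j, i))) := fun y j i => rfl
  have hm' : (0 : ℝ) < m := by exact_mod_cast hm
  let P : (Fin T → Fin m) → ℝ := fun y => (∏ j, w ((E y).1 j)) * (1 / (m : ℝ)) ^ r
  have hPsum : ∑ y, P y = (∑ z, w z) ^ d := by
    have : ∑ y, P y = ∑ p : (Fin d → Fin s → Fin m) × (Fin r → Fin m),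
        (∏ j, w (p.1 j)) * (1 / (m : ℝ)) ^ r :=
      E.sum_comp (fun p => (∏ j, w (p.1 j)) * (1 / (m : ℝ)) ^ r)
    rw [this, Fintype.sum_prod_type]
    have h1 : ∀ g : Fin d → Fin s → Fin m,
        ∑ _h : Fin r → Fin m, (∏ j, w (g j)) * (1 / (m : ℝ)) ^ r = ∏ j, w (g j) := by
      intro g
      rw [Finset.sum_const, Finset.card_univ, Fintype.card_fun, Fintype.card_fin, Fintype.card_fin,
        nsmul_eq_mul, Nat.cast_pow]
      have : (m : ℝ) ^ r ≠ 0 := pow_ne_zero _ hm'.ne'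
      rw [one_div, inv_pow]; field_simp
    simp_rw [h1]
    rw [← Fintype.piFinset_univ, ← Finset.prod_univ_sum]
    simp
  have hPpos : 0 < ∑ y, P y := by rw [hPsum]; positivity
  have hcomp : ∀ y, 0 < P y → ∃ θ ∈ comparators d m B,
      P y ≤ ∏ t, modelProb θ (x₀ (e t)) (y t) := by
    intro y hy
    have hwpos : ∀ j, 0 < w ((E y).1 j) := by
      intro j
      refine lt_of_le_of_ne (hw0 _) fun h => hy.ne' ?_
      simp only [P]
      rw [Finset.prod_eq_zero (Finset.mem_univ j) h.symm, zero_mul]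
    choose v hvB hv using fun j => hw _ (hwpos j)
    refine ⟨fun k j => v j k, fun k => ?_, ?_⟩
    · rw [pi_norm_le_iff_of_nonneg hB]
      exact fun j => hvB j k
    · have h1 : ∏ t, modelProb (fun k j => v j k) (x₀ (e t)) (y t)
          = ∏ u, modelProb (fun k j => v j k) (x₀ u) (y (e.symm u)) := by
        rw [← e.prod_comp]; simp
      rw [h1, Fintype.prod_sum_type, Fintype.prod_prod_type]
      simp only [P]
      refine mul_le_mul ?_ ?_ (by positivity) (Finset.prod_nonneg fun j _ =>
        Finset.prod_nonneg fun i _ => (modelProb_pos _ _ _).le)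
      · refine Finset.prod_le_prod (fun j _ => hw0 _) fun j _ => (hv j).trans (le_of_eq ?_)
        refine Finset.prod_congr rfl fun i _ => ?_
        simp only [x₀, Sum.elim_inl, modelProb_single, hE1]
      · simp only [x₀, Sum.elim_inr, modelProb_zero, Finset.prod_const, Finset.card_univ,
          Fintype.card_fin, le_refl]
  obtain ⟨y, hy⟩ := exists_log_sum_le_regret (B := B) A (fun t => x₀ (e t)) P
      (fun y => mul_nonneg (Finset.prod_nonneg fun j _ => hw0 _) (by positivity)) hPpos hcomp
  refine ⟨fun t => (x₀ (e t), y t), fun t => ?_, ?_⟩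
  · change ‖x₀ (e t)‖ ≤ 1
    rcases e t with p | i
    · simp only [x₀, Sum.elim_inl, Pi.norm_single, norm_one, le_refl]
    · simp [x₀]
  · rwa [hPsum, Real.log_pow] at hy

/-- With zero features in all rounds every comparator predicts uniformly, and some label sequence
makes the algorithm do no better. -/
theorem exists_zero_le_regret {d m T : ℕ} (hm : 1 ≤ m) {B : ℝ} (hB : 0 ≤ B)
    (A : Algorithm d m) :
    ∃ S : Fin T → Example d m, (∀ t, ‖(S t).1‖ ≤ 1) ∧ 0 ≤ regret B A S := by
  have := exists_mul_log_sum_le_regret (d := d) (s := 0) (r := T) (T := T) hm hB (by simp)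
    (fun _ => 1) (by simp) (by simp) (fun z _ => ⟨0, fun _ => by simpa using hB, by simp⟩) A
  simpa using this

/-! ### Words with prescribed letter counts -/

/-- The Stirling sequence decreases from its first term `exp 1 / √2`. -/
theorem factorial_le_stirling {n : ℕ} (hn : 1 ≤ n) :
    (n.factorial : ℝ) ≤ Real.exp 1 * √n * (n / Real.exp 1) ^ n := by
  obtain ⟨k, rfl⟩ : ∃ k, n = k + 1 := ⟨n - 1, by omega⟩
  have h := Stirling.stirlingSeq'_antitone (Nat.zero_le k)
  simp only [Function.comp, Nat.succ_eq_add_one, zero_add, Stirling.stirlingSeq_one] at h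
  rw [Stirling.stirlingSeq, div_le_iff₀ (by positivity)] at h
  refine h.trans (le_of_eq ?_)
  rw [Real.sqrt_mul (by norm_num)]
  have : √(2 : ℝ) ≠ 0 := by positivity
  field_simp

theorem stirling_le_factorial (n : ℕ) : √n * (n / Real.exp 1) ^ n ≤ (n.factorial : ℝ) := by
  refine le_trans ?_ (Stirling.le_factorial_stirling n)
  gcongr
  have := Real.pi_gt_three
  have : (0 : ℝ) ≤ n := by positivity
  nlinarith

/-- The number of occurrences of the letter `j` in the word `z`. -/
def letterCount {m s : ℕ} (z : Fin s → Fin m) (j : Fin m) : ℕ := Fintype.card {i // z i = j}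

theorem prod_apply_eq_prod_pow_letterCount {m s : ℕ} (z : Fin s → Fin m) (g : Fin m → ℝ) :
    ∏ i, g (z i) = ∏ j, g j ^ letterCount z j := by
  rw [← Finset.prod_fiberwise' Finset.univ z g]
  refine Finset.prod_congr rfl fun j _ => ?_
  rw [Finset.prod_const, letterCount, Fintype.card_subtype]

theorem exists_letterCount_eq {m s : ℕ} (k : Fin m → ℕ) (hk : ∑ j, k j = s) :
    ∃ z : Fin s → Fin m, letterCount z = k := by
  let e : Fin s ≃ (Σ j, Fin (k j)) := (finCongr hk.symm).trans finSigmaFinEquiv.symm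
  refine ⟨fun i => (e i).1, funext fun j => ?_⟩
  have h1 : {i // (e i).1 = j} ≃ {p : Σ j, Fin (k j) // p.1 = j} :=
    e.subtypeEquiv fun i => Iff.rfl
  rw [letterCount, Fintype.card_congr h1, Fintype.card_congr (Equiv.sigmaSubtype j)]
  simp

/-- There are at least `s! / ∏ j, (k j)!` words with letter counts `k`: the permutations of the
positions send one such word `z₀` to words with the same counts, and at most
`∏ j, (k j)!` of them give the same word, as they differ by permutations that fix `z₀`. -/
theorem factorial_le_card_mul_prod_factorial {m s : ℕ} (k : Fin m → ℕ) (hk : ∑ j, k j = s) :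
    s.factorial ≤
      (Finset.univ.filter fun z : Fin s → Fin m => letterCount z = k).card
        * ∏ j, (k j).factorial := by
  classical
  obtain ⟨z₀, hz₀⟩ := exists_letterCount_eq k hk
  have h := Finset.card_le_mul_card_image_of_maps_to
    (f := fun g : Equiv.Perm (Fin s) => z₀ ∘ g) (s := Finset.univ)
    (t := Finset.univ.filter fun z : Fin s → Fin m => letterCount z = k) ?_
    (∏ j, (k j).factorial) ?_
  · rw [Finset.card_univ, Fintype.card_perm, Fintype.card_fin] at h
    rwa [mul_comm]
  · intro g _
    simp only [Finset.mem_filter, Finset.mem_univ, true_and]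
    rw [← hz₀]
    funext j
    exact Fintype.card_congr (g.subtypeEquiv fun i => Iff.rfl)
  · intro z _
    have hstab := DomMulAct.stabilizer_card z₀
    have hcard : Fintype.card {g : Equiv.Perm (Fin s) // z₀ ∘ g = z₀} = ∏ j, (k j).factorial := by
      rw [hstab, ← hz₀]; rfl
    rw [← hcard, Fintype.card_subtype]
    rcases Finset.eq_empty_or_nonempty
      (Finset.univ.filter fun g : Equiv.Perm (Fin s) => z₀ ∘ g = z) with h0 | ⟨g₀, hg₀⟩
    · rw [h0]; simp
    · simp only [Finset.mem_filter, Finset.mem_univ, true_and] at hg₀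
      refine Finset.card_le_card_of_injOn (fun g => g * g₀⁻¹) ?_ fun a _ b _ hab =>
        mul_right_cancel hab
      intro g hg
      simp only [Finset.coe_filter, Finset.mem_univ, true_and, Set.mem_ofPred_eq] at hg ⊢
      rw [Equiv.Perm.coe_mul, ← Function.comp_assoc, hg, ← hg₀]
      funext i; simp

/-- The words with letter counts `k` have total probability at least `√s / ∏ j, (e * √(k j))` under
the memoryless source with letter probabilities `k j / s`. -/
theorem le_card_mul_prod_pow {m s : ℕ} (k : Fin m → ℕ) (hk : ∑ j, k j = s)
    (hk1 : ∀ j, 1 ≤ k j) (hs : 1 ≤ s) :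
    √s / ∏ j, (Real.exp 1 * √(k j)) ≤
      ((Finset.univ.filter fun z : Fin s → Fin m => letterCount z = k).card : ℝ)
        * ∏ j, ((k j : ℝ) / s) ^ k j := by
  set N := (Finset.univ.filter fun z : Fin s → Fin m => letterCount z = k).card with hN
  have hs' : (0 : ℝ) < s := by exact_mod_cast hs
  have hk' : ∀ j, (0 : ℝ) < k j := fun j => by exact_mod_cast hk1 j
  have h1 : (s.factorial : ℝ) ≤ N * ∏ j, ((k j).factorial : ℝ) := by
    exact_mod_cast factorial_le_card_mul_prod_factorial k hk
  have h2 : ∏ j, ((k j).factorial : ℝ)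
      ≤ (∏ j, (Real.exp 1 * √(k j))) * ∏ j, ((k j : ℝ) / Real.exp 1) ^ k j := by
    rw [← Finset.prod_mul_distrib]
    exact Finset.prod_le_prod (fun _ _ => by positivity) fun j _ => factorial_le_stirling (hk1 j)
  have h3 : √s * (s / Real.exp 1) ^ s ≤ N * ((∏ j, (Real.exp 1 * √(k j))) *
      ∏ j, ((k j : ℝ) / Real.exp 1) ^ k j) :=
    (stirling_le_factorial s).trans (h1.trans (by gcongr))
  have h4 : ∏ j, ((k j : ℝ) / Real.exp 1) ^ k j
      = (s / Real.exp 1) ^ s * ∏ j, ((k j : ℝ) / s) ^ k j := by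
    rw [← hk, ← Finset.prod_pow_eq_pow_sum, hk, ← Finset.prod_mul_distrib]
    refine Finset.prod_congr rfl fun j _ => ?_
    rw [← mul_pow]
    congr 1
    field_simp
  have hpos : (0 : ℝ) < ∏ j, (Real.exp 1 * √(k j)) :=
    Finset.prod_pos fun j _ => mul_pos (Real.exp_pos _) (Real.sqrt_pos.2 (hk' j))
  rw [h4] at h3
  rw [div_le_iff₀ hpos]
  have hE : (0 : ℝ) < (s / Real.exp 1) ^ s := by positivity
  refine le_of_mul_le_mul_right (h3.trans (le_of_eq ?_)) hE
  ring

/-! ### Windows of letter counts -/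

/-- Letter counts in a window `[a, b]` with `b ≤ (1 + B) * a` have an empirical distribution that
the comparator class contains: since `s` lies between `m * a` and `m * b`, the logarithms of
`m * k j / s` are bounded by `log (b / a) ≤ B`. -/
theorem exists_softmax_eq_div {m s : ℕ} {B : ℝ} (hm : 1 ≤ m) {a b : ℕ} (ha : 1 ≤ a)
    (hab : (b : ℝ) ≤ (1 + B) * a) (k : Fin m → ℕ) (hk : ∑ j, k j = s)
    (hka : ∀ j, a ≤ k j) (hkb : ∀ j, k j ≤ b) :
    ∃ v : Fin m → ℝ, (∀ j, |v j| ≤ B) ∧ ∀ j, softmax v j = (k j : ℝ) / s := by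
  have hm' : (0 : ℝ) < m := by exact_mod_cast hm
  have ha' : (0 : ℝ) < a := by exact_mod_cast ha
  have hka' : ∀ j, (a : ℝ) ≤ k j := fun j => by exact_mod_cast hka j
  have hkb' : ∀ j, (k j : ℝ) ≤ b := fun j => by exact_mod_cast hkb j
  have hk' : ∀ j, (0 : ℝ) < k j := fun j => ha'.trans_le (hka' j)
  have hsum : ∑ j, (k j : ℝ) = s := by exact_mod_cast hk
  have hs1 : (m : ℝ) * a ≤ s := by
    rw [← hsum]
    simpa using Finset.card_nsmul_le_sum Finset.univ (fun j => (k j : ℝ)) a fun j _ => hka' j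
  have hs2 : (s : ℝ) ≤ m * b := by
    rw [← hsum]
    simpa using Finset.sum_le_card_nsmul Finset.univ (fun j => (k j : ℝ)) b fun j _ => hkb' j
  have hs : (0 : ℝ) < s := lt_of_lt_of_le (by positivity) hs1
  have hbe : (b : ℝ) ≤ Real.exp B * a := hab.trans (by
    gcongr; linarith [Real.add_one_le_exp B])
  have hpos : ∀ j, (0 : ℝ) < m * k j / s := fun j => div_pos (mul_pos hm' (hk' j)) hs
  refine ⟨fun j => Real.log (m * k j / s), fun j => ?_, fun j => ?_⟩
  · rw [abs_le, Real.le_log_iff_exp_le (hpos j), Real.log_le_iff_le_exp (hpos j), Real.exp_neg,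
      div_le_iff₀ hs, le_div_iff₀ hs, inv_mul_le_iff₀ (Real.exp_pos B)]
    constructor
    · calc (s : ℝ) ≤ m * b := hs2
        _ ≤ m * (Real.exp B * a) := by gcongr
        _ ≤ m * (Real.exp B * k j) := by gcongr; exact hka j
        _ = _ := by ring
    · calc (m : ℝ) * k j ≤ m * b := by gcongr; exact hkb j
        _ ≤ m * (Real.exp B * a) := by gcongr
        _ = Real.exp B * (m * a) := by ring
        _ ≤ _ := by gcongr
  · simp only [softmax, Real.exp_log (hpos _)]
    rw [← Finset.sum_div, ← Finset.mul_sum, hsum]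
    field_simp

/-- Among the `w ^ m` vectors with entries in `[a, a + w)` the sum takes at most `m * w` values, so
one of them is attained at least `w ^ (m - 1) / m` times. -/
theorem exists_many_with_equal_sum {m a w : ℕ} (hm : 1 ≤ m) (hw : 1 ≤ w) :
    ∃ s, m * a ≤ s ∧ s ≤ m * (a + w) ∧ (w : ℝ) ^ (m - 1) / m ≤
      (((Fintype.piFinset fun _ : Fin m => Finset.Ico a (a + w)).filter
        fun k => ∑ j, k j = s).card : ℝ) := by
  have hm' : (0 : ℝ) < m := by exact_mod_cast hm
  have hmaps : ∀ k ∈ Fintype.piFinset fun _ : Fin m => Finset.Ico a (a + w),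
      ∑ j, k j ∈ Finset.Ico (m * a) (m * (a + w)) := by
    intro k hk
    simp only [Fintype.mem_piFinset, Finset.mem_Ico] at hk ⊢
    have : Nonempty (Fin m) := ⟨⟨0, hm⟩⟩
    constructor
    · simpa using Finset.card_nsmul_le_sum Finset.univ k a fun j _ => (hk j).1
    · simpa using Finset.sum_lt_sum_of_nonempty (s := Finset.univ) (f := k)
        (g := fun _ => a + w) Finset.univ_nonempty fun j _ => (hk j).2
  have hnonempty : (Finset.Ico (m * a) (m * (a + w))).Nonempty := by
    rw [Finset.nonempty_Ico]; nlinarith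
  have hcard : (Finset.Ico (m * a) (m * (a + w))).card • ((w : ℝ) ^ (m - 1) / m) ≤
      ((Fintype.piFinset fun _ : Fin m => Finset.Ico a (a + w)).card : ℝ) := by
    have h1 : m * (a + w) - m * a = m * w := by rw [mul_add]; omega
    have h2 : (w : ℝ) ^ m = w ^ (m - 1) * w := by rw [← pow_succ, Nat.sub_add_cancel hm]
    rw [Nat.card_Ico, h1, Fintype.card_piFinset]
    simp only [Nat.card_Ico, add_tsub_cancel_left, Finset.prod_const, Finset.card_univ,
      Fintype.card_fin, nsmul_eq_mul]
    push_cast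
    rw [h2]
    apply le_of_eq
    field_simp
  obtain ⟨s, hs, h⟩ :=
    Finset.exists_le_card_fiber_of_nsmul_le_card_of_maps_to hmaps hnonempty hcard
  rw [Finset.mem_Ico] at hs
  exact ⟨s, hs.1, hs.2.le, h⟩

/-- The regret forced by `d` sources restricted to letter counts in `[a, a + w)`: the number of count
vectors times the least weight of one of them, in the logarithm. -/
theorem exists_mul_log_le_regret {d m a w T : ℕ} {B : ℝ} (hm : 1 ≤ m)
    (ha : 1 ≤ a) (hw : 1 ≤ w) (hwa : w ≤ a) (hwB : (w : ℝ) ≤ B * a)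
    (hT : 2 * a * m * d ≤ T) (A : Algorithm d m) :
    ∃ S : Fin T → Example d m, (∀ t, ‖(S t).1‖ ≤ 1) ∧
      (((d : ℝ) * Real.log ((w : ℝ) ^ (m - 1) / m *
        (√(m * a) / (Real.exp 1 * √(2 * a)) ^ m)) : ℝ) : EReal) ≤ regret B A S := by
  classical
  obtain ⟨s, hs1, hs2, hcard⟩ := exists_many_with_equal_sum (a := a) hm hw
  set K := (Fintype.piFinset fun _ : Fin m => Finset.Ico a (a + w)).filter
        fun k => ∑ j, k j = s with hK
  have hKm : ∀ k ∈ K, (∀ j, a ≤ k j ∧ k j < a + w) ∧ ∑ j, k j = s := by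
    intro k hk
    simpa [hK] using hk
  have hm' : (0 : ℝ) < m := by exact_mod_cast hm
  have ha' : (0 : ℝ) < a := by exact_mod_cast ha
  have hw' : (0 : ℝ) < w := by exact_mod_cast hw
  have hB : 0 ≤ B := by
    by_contra! h
    nlinarith
  have hs : 1 ≤ s := le_trans (Nat.mul_pos hm ha) hs1
  have hsd : d * s ≤ T := by
    calc d * s ≤ d * (m * (a + w)) := by gcongr
      _ ≤ d * (m * (a + a)) := by gcongr
      _ = 2 * a * m * d := by ring
      _ ≤ T := hT
  let p : (Fin m → ℕ) → ℝ := fun k => ∏ j, ((k j : ℝ) / s) ^ k j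
  let f : (Fin s → Fin m) → ℝ := fun z => if letterCount z ∈ K then p (letterCount z) else 0
  have hp0 : ∀ k, 0 ≤ p k := fun k => by positivity
  have hlow : (w : ℝ) ^ (m - 1) / m * (√(m * a) / (Real.exp 1 * √(2 * a)) ^ m) ≤ ∑ z, f z := by
    have h1 : ∑ z, f z = ∑ k ∈ K,
        ((Finset.univ.filter fun z : Fin s → Fin m => letterCount z = k).card : ℝ) * p k := by
      rw [← Finset.sum_filter, ← Finset.sum_fiberwise_of_maps_to (t := K) (g := letterCount)
        (fun z hz => (Finset.mem_filter.1 hz).2)]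
      refine Finset.sum_congr rfl fun k hk => ?_
      rw [Finset.filter_filter]
      have : (Finset.univ.filter fun z : Fin s → Fin m => letterCount z ∈ K ∧ letterCount z = k)
          = Finset.univ.filter fun z : Fin s → Fin m => letterCount z = k := by
        refine Finset.filter_congr fun z _ => ⟨fun h => h.2, fun h => ⟨h ▸ hk, h⟩⟩
      rw [this, ← nsmul_eq_mul]
      refine Finset.sum_eq_card_nsmul fun z hz => ?_
      rw [(Finset.mem_filter.1 hz).2]
    have h2 : ∀ k ∈ K, √(m * a) / (Real.exp 1 * √(2 * a)) ^ m ≤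
        ((Finset.univ.filter fun z : Fin s → Fin m => letterCount z = k).card : ℝ) * p k := by
      intro k hk
      obtain ⟨hka, hks⟩ := hKm k hk
      refine le_trans ?_ (le_card_mul_prod_pow k hks (fun j => ha.trans (hka j).1) hs)
      refine div_le_div₀ (by positivity) ?_ ?_ ?_
      · exact Real.sqrt_le_sqrt (by exact_mod_cast hs1)
      · exact Finset.prod_pos fun j _ => mul_pos (Real.exp_pos _) (Real.sqrt_pos.2
          (by exact_mod_cast ha.trans (hka j).1))
      · have : ∏ j, (Real.exp 1 * √(k j)) ≤ ∏ _j : Fin m, (Real.exp 1 * √(2 * a)) := by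
          refine Finset.prod_le_prod (fun _ _ => by positivity) fun j _ => ?_
          gcongr
          have : k j ≤ 2 * a := by have := (hka j).2; omega
          exact_mod_cast this
        simpa using this
    rw [h1]
    calc _ ≤ (K.card : ℝ) * (√(m * a) / (Real.exp 1 * √(2 * a)) ^ m) := by gcongr
      _ ≤ _ := by
        rw [← nsmul_eq_mul]
        exact Finset.card_nsmul_le_sum _ _ _ h2
  have hlow0 : 0 < (w : ℝ) ^ (m - 1) / m * (√(m * a) / (Real.exp 1 * √(2 * a)) ^ m) := by
    positivity
  have hcomp : ∀ z, 0 < f z →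
      ∃ v : Fin m → ℝ, (∀ j, |v j| ≤ B) ∧ f z ≤ ∏ i, softmax v (z i) := by
    intro z hz
    have hzK : letterCount z ∈ K := by
      by_contra h
      simp [f, h] at hz
    obtain ⟨hka, hks⟩ := hKm _ hzK
    obtain ⟨v, hvB, hv⟩ := exists_softmax_eq_div (B := B) (b := a + w) hm ha
      (by push_cast; linarith) _ hks (fun j => (hka j).1) (fun j => (hka j).2.le)
    refine ⟨v, hvB, le_of_eq ?_⟩
    rw [prod_apply_eq_prod_pow_letterCount]
    simp only [f, if_pos hzK, p, hv]
  obtain ⟨S, hS, hreg⟩ := exists_mul_log_sum_le_regret hm hB (Nat.add_sub_cancel' hsd) f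
    (fun z => by simp only [f]; split_ifs; exacts [hp0 _, le_rfl]) (hlow0.trans_le hlow) hcomp A
  refine ⟨S, hS, le_trans (EReal.coe_le_coe_iff.2 ?_) hreg⟩
  gcongr

/-! ### Asymptotics -/

/-- The logarithm of the single-source sum when `a` and `w` are of order `ρ`. The `m - 1` free counts
contribute `(m - 1) * log ρ`, and the square roots of Stirling's formula take away half of this;
all other terms are linear in `m`, hence in `m - 1` as `2 ≤ m`. -/
theorem half_mul_log_sub_le_log {m a w : ℕ} {c ρ : ℝ} (hm : 2 ≤ m) (hc : 0 < c)
    (ha1 : ρ / 4 ≤ a) (ha2 : 2 * (a : ℝ) ≤ ρ) (hw : c * ρ / 8 ≤ w) (hρ : 0 < ρ) :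
    ((m : ℝ) - 1) / 2 * (Real.log ρ - 2 * (Real.log (8 / c) + 4)) ≤
      Real.log ((w : ℝ) ^ (m - 1) / m * (√(m * a) / (Real.exp 1 * √(2 * a)) ^ m)) := by
  have hm2 : (2 : ℝ) ≤ m := by exact_mod_cast hm
  have hm' : (0 : ℝ) < m := by linarith
  have ha' : (0 : ℝ) < a := by linarith
  have hw' : (0 : ℝ) < w := lt_of_lt_of_le (by positivity) hw
  have hlogw : Real.log ρ - Real.log (8 / c) ≤ Real.log w := by
    rw [← Real.log_div hρ.ne' (by positivity)]
    refine Real.log_le_log (by positivity) (le_trans (le_of_eq ?_) hw)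
    field_simp
  have hloga : Real.log ρ - Real.log 4 ≤ Real.log a := by
    rw [← Real.log_div hρ.ne' (by positivity)]
    exact Real.log_le_log (by positivity) ha1
  have hlog2a : Real.log (2 * a) ≤ Real.log ρ := Real.log_le_log (by positivity) ha2
  have hlogm : Real.log m ≤ m - 1 := Real.log_le_sub_one_of_pos hm'
  have hlog4 : Real.log 4 ≤ 3 := by
    have := Real.log_le_sub_one_of_pos (show (0 : ℝ) < 4 by norm_num)
    linarith
  have hexpand : Real.log ((w : ℝ) ^ (m - 1) / m * (√(m * a) / (Real.exp 1 * √(2 * a)) ^ m))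
      = (m - 1) * Real.log w - Real.log m + (Real.log m + Real.log a) / 2
        - m * (1 + Real.log (2 * a) / 2) := by
    rw [Real.log_mul (by positivity) (by positivity), Real.log_div (by positivity) (by positivity),
      Real.log_div (by positivity) (by positivity), Real.log_pow, Real.log_pow,
      Real.log_mul (Real.exp_pos 1).ne' (by positivity), Real.log_exp,
      Real.log_sqrt (by positivity), Real.log_sqrt (by positivity),
      Real.log_mul hm'.ne' ha'.ne', Nat.cast_sub (by omega)]
    push_cast
    ring
  rw [hexpand]
  have h1 : ((m : ℝ) - 1) * (Real.log ρ - Real.log (8 / c)) ≤ (m - 1) * Real.log w :=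
    mul_le_mul_of_nonneg_left hlogw (by linarith)
  have h2 : (m : ℝ) * (1 + Real.log (2 * a) / 2) ≤ m * (1 + Real.log ρ / 2) := by gcongr
  linarith

/-- The bound for a single horizon, with an error term that depends on `B₀` only. -/
theorem exists_le_regret_of_ratio_large {d m T : ℕ} {B B₀ : ℝ} (hd : 1 ≤ d) (hm : 1 ≤ m)
    (hB₀ : 0 < B₀) (hB : B₀ ≤ B)
    (hρ : 16 / min B₀ 1 ≤ (T : ℝ) / ((m : ℝ) * (d : ℝ))) (A : Algorithm d m) :
    ∃ S : Fin T → Example d m, (∀ t, ‖(S t).1‖ ≤ 1) ∧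
      ((((d : ℝ) * ((m : ℝ) - 1) / 2) * (Real.log ((T : ℝ) / ((m : ℝ) * (d : ℝ)))
        - 2 * (Real.log (8 / min B₀ 1) + 4)) : ℝ) : EReal) ≤ regret B A S := by
  rcases hm.eq_or_lt with rfl | hm2
  · simpa using exists_zero_le_regret (T := T) le_rfl (hB₀.le.trans hB) A
  set c := min B₀ 1 with hc
  set ρ := (T : ℝ) / ((m : ℝ) * (d : ℝ)) with hρdef
  have hc0 : 0 < c := lt_min hB₀ one_pos
  have hc1 : c ≤ 1 := min_le_right _ _
  have hd' : (0 : ℝ) < d := by exact_mod_cast hd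
  have hm' : (0 : ℝ) < m := by exact_mod_cast hm
  have hcρ : 16 ≤ c * ρ := by rwa [div_le_iff₀' hc0] at hρ
  have hρ0 : 0 < ρ := pos_of_mul_pos_right (by linarith) hc0.le
  have hρ16 : 16 ≤ ρ := by nlinarith
  have ha := Nat.floor_le (show 0 ≤ ρ / 2 by positivity)
  have ha' := Nat.lt_floor_add_one (ρ / 2)
  set a := ⌊ρ / 2⌋₊
  have hw := Nat.floor_le (show 0 ≤ c * (a : ℝ) by positivity)
  have hw' := Nat.lt_floor_add_one (c * (a : ℝ))
  set w := ⌊c * (a : ℝ)⌋₊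
  -- The threshold `16 / c` makes up for both roundings.
  have hcw : c * ρ / 8 ≤ w := by nlinarith
  have ha1 : 1 ≤ a := by
    have : (0 : ℝ) < a := by linarith
    exact_mod_cast this
  have hw1 : 1 ≤ w := by
    have : (0 : ℝ) < w := by linarith
    exact_mod_cast this
  have hwa : w ≤ a := by
    have : (w : ℝ) ≤ a := hw.trans (mul_le_of_le_one_left (by positivity) hc1)
    exact_mod_cast this
  have hwB : (w : ℝ) ≤ B * a := hw.trans (by gcongr; exact (min_le_left _ _).trans hB)
  have hT : 2 * a * m * d ≤ T := by
    have h1 : (2 * a * m * d : ℝ) ≤ T := by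
      have : ρ * (m * d) = T := by rw [hρdef]; field_simp
      rw [← this, mul_assoc]
      gcongr
      linarith
    exact_mod_cast h1
  obtain ⟨S, hS, hreg⟩ := exists_mul_log_le_regret hm ha1 hw1 hwa hwB hT A
  refine ⟨S, hS, le_trans (EReal.coe_le_coe_iff.2 ?_) hreg⟩
  have := half_mul_log_sub_le_log (a := a) hm2 hc0 (by linarith) (by linarith) hcw hρ0
  calc _ = (d : ℝ) * (((m : ℝ) - 1) / 2 * (Real.log ρ - 2 * (Real.log (8 / c) + 4))) := by ring
    _ ≤ _ := by gcongr

/-- With `u = T / d`, the hypothesis and `1 ≤ m` give `u ^ (1 - ε) → ∞`, and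
`u / m ≥ u ^ ε = (u ^ (1 - ε)) ^ (ε / (1 - ε))`. -/
theorem tendsto_ratio_atTop {ε : ℝ} (hε : 0 < ε) (hε1 : ε < 1) (d m : ℕ → ℕ)
    (hm : ∀ T, 1 ≤ m T)
    (hmo : (fun T : ℕ => (m T : ℝ)) =o[atTop]
      (fun T : ℕ => ((T : ℝ) / (d T : ℝ)) ^ (1 - ε))) :
    Tendsto (fun T : ℕ => (T : ℝ) / ((m T : ℝ) * (d T : ℝ))) atTop atTop := by
  set u : ℕ → ℝ := fun T => (T : ℝ) / (d T : ℝ) with hu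
  have hu0 : ∀ T, 0 ≤ u T := fun T => by positivity
  have hm1 : ∀ T, (1 : ℝ) ≤ m T := fun T => by exact_mod_cast hm T
  have hone : (fun _ : ℕ => (1 : ℝ)) =o[atTop] fun T => u T ^ (1 - ε) := by
    refine IsBigO.trans_isLittleO (IsBigO.of_bound 1 (Eventually.of_forall fun T => ?_)) hmo
    simpa using hm1 T
  have hpow : Tendsto (fun T => u T ^ (1 - ε)) atTop atTop := by
    have := (isLittleO_const_left_of_ne (one_ne_zero (α := ℝ))).1 hone
    refine this.congr fun T => ?_
    rw [Real.norm_of_nonneg (Real.rpow_nonneg (hu0 T) _)]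
  have hε' : 0 < ε / (1 - ε) := div_pos hε (by linarith)
  have hpow' : Tendsto (fun T => (u T ^ (1 - ε)) ^ (ε / (1 - ε))) atTop atTop :=
    (tendsto_rpow_atTop hε').comp hpow
  refine tendsto_atTop_mono' _ ?_ hpow'
  filter_upwards [hmo.bound one_pos, hpow.eventually_gt_atTop 0] with T hT hT0
  have hu1 : 0 < u T := by
    refine (hu0 T).lt_of_ne fun h => ?_
    rw [← h, Real.zero_rpow (by linarith)] at hT0
    exact lt_irrefl _ hT0
  have hmT : (m T : ℝ) ≤ u T ^ (1 - ε) := by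
    rwa [one_mul, Real.norm_of_nonneg (by positivity), Real.norm_of_nonneg hT0.le] at hT
  have hm0 : (0 : ℝ) < m T := one_pos.trans_le (hm1 T)
  rw [← Real.rpow_mul hu1.le, mul_div_cancel₀ _ (by linarith), mul_comm (m T : ℝ), ← div_div,
    le_div_iff₀ hm0]
  calc u T ^ ε * m T ≤ u T ^ ε * u T ^ (1 - ε) := by gcongr
    _ = u T := by rw [← Real.rpow_add hu1]; simp

/-- For `1 ≤ ε`, a ratio `T / d > 1` would give `m ≤ (T / d) ^ (1 - ε) / 2 ≤ 1 / 2`. -/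
theorem eventually_log_ratio_nonpos {ε : ℝ} (hε1 : 1 ≤ ε) (d m : ℕ → ℕ)
    (hm : ∀ T, 1 ≤ m T)
    (hmo : (fun T : ℕ => (m T : ℝ)) =o[atTop]
      (fun T : ℕ => ((T : ℝ) / (d T : ℝ)) ^ (1 - ε))) :
    ∀ᶠ T : ℕ in atTop, Real.log ((T : ℝ) / ((m T : ℝ) * (d T : ℝ))) ≤ 0 := by
  filter_upwards [hmo.bound (half_pos one_pos)] with T hT
  have hm1 : (1 : ℝ) ≤ m T := by exact_mod_cast hm T
  have hu : (T : ℝ) / (d T : ℝ) ≤ 1 := by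
    by_contra! h
    have h1 := Real.rpow_le_one_of_one_le_of_nonpos h.le (show 1 - ε ≤ 0 by linarith)
    rw [Real.norm_of_nonneg (by positivity),
      Real.norm_of_nonneg (Real.rpow_nonneg (by positivity) _)] at hT
    linarith
  refine Real.log_nonpos (by positivity) ?_
  rw [mul_comm, ← div_div]
  exact div_le_one_of_le₀ (hu.trans hm1) (by positivity)

end OnlineLogistic

theorem mainTheorem5
    (ε : ℝ) (hε : 0 < ε)
    (B : ℕ → ℝ) (B₀ : ℝ) (hB₀ : 0 < B₀) (hB : ∀ᶠ T in atTop, B₀ ≤ B T)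
    (d m : ℕ → ℕ) (hd : ∀ T, 1 ≤ d T) (hm : ∀ T, 1 ≤ m T)
    (hmo : (fun T : ℕ => (m T : ℝ)) =o[atTop]
      (fun T : ℕ => ((T : ℝ) / (d T : ℝ)) ^ (1 - ε))) :
    ∃ r : ℕ → ℝ, Tendsto r atTop (𝓝 0) ∧
      ∀ᶠ T : ℕ in atTop, ∀ A : OnlineLogistic.Algorithm (d T) (m T),
        ∃ S : Fin T → OnlineLogistic.Example (d T) (m T),
          (∀ t, ‖(S t).1‖ ≤ 1) ∧
          (((1 - r T) * ((d T : ℝ) * ((m T : ℝ) - 1) / 2)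
              * Real.log ((T : ℝ) / ((m T : ℝ) * (d T : ℝ))) : ℝ) : EReal)
            ≤ OnlineLogistic.regret (B T) A S := by
  rcases lt_or_ge ε 1 with hε1 | hε1
  · have hρ := OnlineLogistic.tendsto_ratio_atTop hε hε1 d m hm hmo
    have hlog := Real.tendsto_log_atTop.comp hρ
    refine ⟨fun T => 2 * (Real.log (8 / min B₀ 1) + 4)
      / Real.log ((T : ℝ) / ((m T : ℝ) * (d T : ℝ))), hlog.const_div_atTop _, ?_⟩
    filter_upwards [hB, hρ.eventually_ge_atTop (16 / min B₀ 1), hlog.eventually_gt_atTop 0]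
      with T hBT hρT hlogT A
    obtain ⟨S, hS, hreg⟩ :=
      OnlineLogistic.exists_le_regret_of_ratio_large (hd T) (hm T) hB₀ hBT hρT A
    refine ⟨S, hS, le_trans (le_of_eq ?_) hreg⟩
    simp only [Function.comp_apply] at hlogT
    congr 1
    field_simp
  · refine ⟨fun _ => 0, tendsto_const_nhds, ?_⟩
    filter_upwards [hB, OnlineLogistic.eventually_log_ratio_nonpos hε1 d m hm hmo]
      with T hBT hlogT A
    obtain ⟨S, hS, hreg⟩ := OnlineLogistic.exists_zero_le_regret (T := T) (hm T)
      (hB₀.le.trans hBT) A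
    refine ⟨S, hS, le_trans ?_ hreg⟩
    have hm1 : (1 : ℝ) ≤ m T := by exact_mod_cast hm T
    rw [← EReal.coe_zero, EReal.coe_le_coe_iff, sub_zero, one_mul]
    exact mul_nonpos_of_nonneg_of_nonpos
      (div_nonneg (mul_nonneg (by positivity) (by linarith)) zero_le_two) hlogT
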